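/- Let $m\ge 1$ and index $2^m$ physical qubits by the vertices of the hypercube $\mathbb{Z}_2^m$, with standard basis $e_1,\dots,e_m$. For $J\subseteq[m]$ let $\langle J\rangle\subseteq\mathbb{Z}_2^m$ be the subgroup generated by $\{e_i : i\in J\}$ (the bit strings supported in $J$); its cosets $x+\langle J\rangle$ are the $|J|$-dimensional subcubes. For a single-qubit unitary $U$ and $A\subseteq\mathbb{Z}_2^m$, let $U_A$ denote the operator acting as $U$ on the qubits in $A$ and as the identity on the others, and for $k\in\mathbb{Z}$ let $Z(k)=|0\rangle\langle 0|+e^{i\pi/2^k}|1\rangle\langle 1|$ (so $Z(-1)=\mathbb{I}$ and $Z(0)=Z$). The hypercube code $QRM_m(0,1)$ is the common $+1$ eigenspace of the group generated by the operator $X_{\mathbb{Z}_2^m}$ and the operators $Z_A$, where $A$ ranges over the $2$-dimensional subcubes. It encodes $m$ logical qubits $\bar 1,\dots,\bar m$, where the $i$-th logical qubit is defined by the logical Pauli operators $\overline{Z}_i=Z_{\langle\{i\}\rangle}$ and $\overline{X}_i=X_{e_i+\langle[m]\setminus\{i\}\rangle}$; that is, there is an isometry from $(\mathbb{C}^2)^{\otimes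 m}$ onto the code space that intertwines $Z_i$ with $\overline Z_i$ and $X_i$ with $\overline X_i$ for every $i$ (an encoder). For a set $\mathcal{J}$ of logical qubits, $C^{\mathcal{J}}Z$ is the multi-controlled-$Z$ gate that multiplies by $-1$ the computational basis states equal to $1$ on all qubits of $\mathcal{J}$ and fixes the other basis states, with the convention $C^{\emptyset}Z=\mathbb{I}$; for a collection $\mathcal{F}$ of such sets, $C^{\mathcal{F}}Z=\prod_{\mathcal{J}\in\mathcal{F}}C^{\mathcal{J}}Z$. Then for every $K\subseteq[m]$, the transversal operator $Z(|K|-1)_{\langle K\rangle}$ preserves the code space of $QRM_m(0,1)$ and implements on it the logical circuit $$Z(|K|-1)_{\langle K\rangle}\;\equiv\;\overline{C^{\mathcal{P}(K)}Z}=\prod_{\mathcal{J}\subseteq\{\bar i\,:\,i\in K\}}\overline{C^{\mathcal{J}}Z},$$ that is, $Z(|K|-1)_{\langle K\rangle}\,E=E\,C^{\mathcal{P}(K)}Z$ for every encoder $E$, where $\mathcal{P}(K)$ is the collection of all subsets of $\{\bar i : i\in K\}$. -/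

import Mathlib

noncomputable section

namespace QRM

/-! ### Qubits, tensor products of single-qubit gates -/

/-- The unitary group of a register of qubits indexed by `ι`; the computational basis is
`ι → Fin 2`, and states are vectors `(ι → Fin 2) → ℂ`. -/
abbrev QGate (ι : Type) [Fintype ι] [DecidableEq ι] : Type :=
  Matrix.unitaryGroup (ι → Fin 2) ℂ

/-- The matrix of the tensor product `⨂ i, U i` of `2 × 2` matrices. -/
def tensorMatrix {ι : Type} [Fintype ι] (U : ι → Matrix (Fin 2) (Fin 2) ℂ) :
    Matrix (ι → Fin 2) (ι → Fin 2) ℂ :=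
  Matrix.of fun s t => ∏ i, U i (s i) (t i)

theorem tensorMatrix_mul {ι : Type} [Fintype ι] [DecidableEq ι]
    (U V : ι → Matrix (Fin 2) (Fin 2) ℂ) :
    tensorMatrix U * tensorMatrix V = tensorMatrix (fun i => U i * V i) := by
  ext s t
  simp only [tensorMatrix, Matrix.mul_apply, Matrix.of_apply, ← Finset.prod_mul_distrib]
  rw [Finset.prod_univ_sum, Fintype.piFinset_univ]

theorem tensorMatrix_one {ι : Type} [Fintype ι] [DecidableEq ι] :
    tensorMatrix (fun _ : ι => (1 : Matrix (Fin 2) (Fin 2) ℂ)) = 1 := by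
  ext s t
  by_cases h : s = t
  · subst h; simp [tensorMatrix]
  · obtain ⟨i, hi⟩ := Function.ne_iff.mp h
    simp only [tensorMatrix, Matrix.of_apply, Matrix.one_apply_ne h]
    exact Finset.prod_eq_zero (Finset.mem_univ i) (Matrix.one_apply_ne hi)

theorem tensorMatrix_star {ι : Type} [Fintype ι] (U : ι → Matrix (Fin 2) (Fin 2) ℂ) :
    star (tensorMatrix U) = tensorMatrix (fun i => star (U i)) := by
  ext s t
  simp [tensorMatrix, Matrix.star_apply]

/-- The tensor product `⨂ i, U i` of single-qubit unitaries. -/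
def tensor {ι : Type} [Fintype ι] [DecidableEq ι]
    (U : ι → Matrix.unitaryGroup (Fin 2) ℂ) : QGate ι :=
  ⟨tensorMatrix fun i => (U i : Matrix (Fin 2) (Fin 2) ℂ), by
    rw [Matrix.mem_unitaryGroup_iff, tensorMatrix_star, tensorMatrix_mul]
    rw [← tensorMatrix_one]
    congr 1
    funext i
    exact Matrix.mem_unitaryGroup_iff.mp (U i).2⟩

open Classical in
/-- The transversal operator `U_A`: the gate `U` on every qubit of `A`, identity elsewhere. -/
def onSet {ι : Type} [Fintype ι] [DecidableEq ι] (U : Matrix.unitaryGroup (Fin 2) ℂ)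
    (A : Set ι) : QGate ι :=
  tensor fun i => if i ∈ A then U else 1

/-- Pauli `X`. -/
def pauliX : Matrix.unitaryGroup (Fin 2) ℂ :=
  ⟨!![0, 1; 1, 0], by
    rw [Matrix.mem_unitaryGroup_iff]
    ext i j; fin_cases i <;> fin_cases j <;> simp [Matrix.mul_apply, Matrix.star_apply]⟩

/-- Pauli `Z`. -/
def pauliZ : Matrix.unitaryGroup (Fin 2) ℂ :=
  ⟨!![1, 0; 0, -1], by
    rw [Matrix.mem_unitaryGroup_iff]
    ext i j; fin_cases i <;> fin_cases j <;> simp [Matrix.mul_apply, Matrix.star_apply]⟩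

/-- The gate `Z(k) = |0⟩⟨0| + exp(iπ / 2 ^ k) |1⟩⟨1|`, for `k ∈ ℤ`; in particular `Z(-1)` is the
identity and `Z(0)` is Pauli `Z`. -/
def zRot (k : ℤ) : Matrix.unitaryGroup (Fin 2) ℂ :=
  ⟨!![1, 0; 0, Complex.exp (((Real.pi / (2 : ℝ) ^ k : ℝ) : ℂ) * Complex.I)], by
    rw [Matrix.mem_unitaryGroup_iff]
    ext i j
    fin_cases i <;> fin_cases j <;>
      simp [-Complex.ofReal_div, Matrix.mul_apply, Matrix.star_apply, Complex.mul_conj,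
        Complex.normSq_eq_norm_sq, Complex.norm_exp_ofReal_mul_I]⟩

theorem zRot_neg_one : zRot (-1) = 1 := by
  apply Subtype.ext
  have h : Complex.exp (((Real.pi / (2 : ℝ) ^ (-1 : ℤ) : ℝ) : ℂ) * Complex.I) = 1 := by
    rw [← Complex.exp_two_pi_mul_I]
    congr 1
    push_cast
    simp only [zpow_neg_one, div_inv_eq_mul]
    ring
  simp only [zRot, h]
  ext i j
  fin_cases i <;> fin_cases j <;> simp

theorem zRot_zero : zRot 0 = pauliZ := by
  apply Subtype.ext
  ext i j
  fin_cases i <;> fin_cases j <;> simp [zRot, pauliZ]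

/-! ### Multi-controlled-`Z` circuits -/

open Classical in
/-- The gate `C^I Z` on a register of qubits: the phase `-1` on every computational basis state
that is `1` on all qubits of `I`, and identity on the other basis states; by convention, `C^∅ Z`
is the identity. -/
def ctrlZ {ι : Type} [Fintype ι] [DecidableEq ι] (I : Finset ι) :
    Matrix (ι → Fin 2) (ι → Fin 2) ℂ :=
  Matrix.diagonal fun s => if I.Nonempty ∧ ∀ i ∈ I, s i = 1 then -1 else 1

theorem ctrlZ_commute {ι : Type} [Fintype ι] [DecidableEq ι] (I J : Finset ι) :
    Commute (ctrlZ I) (ctrlZ J) :=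
  Matrix.commute_diagonal _ _

/-- The circuit `C^F Z = ∏_{I ∈ F} C^I Z`. -/
def ctrlZCircuit {ι : Type} [Fintype ι] [DecidableEq ι] (F : Finset (Finset ι)) :
    Matrix (ι → Fin 2) (ι → Fin 2) ℂ :=
  F.noncommProd ctrlZ fun I _ J _ _ => ctrlZ_commute I J

/-! ### The hypercube and its subcubes -/

/-- The vertices of the `m`-dimensional hypercube. -/
abbrev Cube (m : ℕ) : Type := Fin m → ZMod 2

/-- The bit string `e_J`, with ones exactly at the positions in `J`. -/
def incidence {m : ℕ} (J : Finset (Fin m)) : Cube m := fun i => if i ∈ J then 1 else 0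

/-- The standard subcube `⟨J⟩`: the bit strings supported in `J`. -/
def stdCube {m : ℕ} (J : Finset (Fin m)) : Set (Cube m) := {x | ∀ i, i ∉ J → x i = 0}

/-- The standard subcube `⟨J⟩` is the subgroup generated by the unit vectors `e_i`, `i ∈ J`. -/
theorem stdCube_eq_closure {m : ℕ} (J : Finset (Fin m)) :
    stdCube J =
      (AddSubgroup.closure ((fun i : Fin m => (Pi.single i 1 : Cube m)) '' (J : Set (Fin m))) :
        Set (Cube m)) := by
  apply Set.Subset.antisymm
  · intro x hx
    have hsum : x = ∑ i, (x i).val • (Pi.single i 1 : Cube m) := by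
      funext j
      rw [Finset.sum_apply, Finset.sum_eq_single j]
      · rw [Pi.smul_apply, Pi.single_eq_same, nsmul_eq_mul, mul_one, ZMod.natCast_zmod_val]
      · intro i _ hij
        rw [Pi.smul_apply, Pi.single_eq_of_ne hij.symm, smul_zero]
      · intro h
        exact absurd (Finset.mem_univ j) h
    rw [hsum]
    refine AddSubgroup.sum_mem _ fun i _ => ?_
    by_cases hi : i ∈ J
    · exact AddSubgroup.nsmul_mem _
        (AddSubgroup.subset_closure (Set.mem_image_of_mem _ (Finset.mem_coe.mpr hi))) _
    · rw [hx i hi]; simp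
  · intro x hx
    induction hx using AddSubgroup.closure_induction with
    | mem x hx =>
      obtain ⟨j, hj, rfl⟩ := hx
      intro i hi
      have hij : i ≠ j := fun h => hi (h ▸ hj)
      simp [hij]
    | zero => intro i _; rfl
    | add x y _ _ hx hy => intro i hi; simp [hx i hi, hy i hi]
    | neg x _ hx => intro i hi; simp [hx i hi]

/-- The subcube `x + ⟨J⟩` of type `J`. -/
def subcube {m : ℕ} (x : Cube m) (J : Finset (Fin m)) : Set (Cube m) :=
  (fun y => x + y) '' stdCube J

/-- `A` is a subcube of dimension `d`. -/
def IsSubcube {m : ℕ} (d : ℕ) (A : Set (Cube m)) : Prop :=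
  ∃ (x : Cube m) (J : Finset (Fin m)), J.card = d ∧ A = subcube x J

/-! ### Quantum Reed--Muller codes -/

/-- The stabilizer group of `QRM_m(q, r)` (for `q ≤ r ≤ m`) on qubits indexed by the vertices of the
hypercube, generated by `X_A` for the `(m - q)`-cubes `A` and `Z_A` for the `(r + 1)`-cubes `A`. -/
def stabilizer (m q r : ℕ) : Subgroup (QGate (Cube m)) :=
  Subgroup.closure
    ({S | ∃ A, IsSubcube (m - q) A ∧ S = onSet pauliX A} ∪
      {S | ∃ A, IsSubcube (r + 1) A ∧ S = onSet pauliZ A})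

/-- The code space of `QRM_m(q, r)`: the common `+1` eigenspace of the stabilizer group. -/
def code (m q r : ℕ) : Submodule ℂ ((Cube m → Fin 2) → ℂ) :=
  ⨅ S ∈ stabilizer m q r, LinearMap.ker
    (Matrix.mulVecLin ((S : Matrix (Cube m → Fin 2) (Cube m → Fin 2) ℂ) - 1))

theorem mem_code {m q r : ℕ} (ψ : (Cube m → Fin 2) → ℂ) :
    ψ ∈ code m q r ↔ ∀ S ∈ stabilizer m q r,
      (S : Matrix (Cube m → Fin 2) (Cube m → Fin 2) ℂ).mulVec ψ = ψ := by
  simp [code, Submodule.mem_iInf, sub_eq_zero]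

/-- The index set `{J ⊆ [m] : q + 1 ≤ |J| ≤ r}` of the logical qubits of `QRM_m(q, r)`. -/
abbrev LogicalQubit (m q r : ℕ) : Type :=
  {J : Finset (Fin m) // q + 1 ≤ J.card ∧ J.card ≤ r}

/-- The logical operator `Z_⟨J⟩`, the `Z` operator of the `J`-th logical qubit. -/
def logicalZ {m q r : ℕ} (J : LogicalQubit m q r) : QGate (Cube m) :=
  onSet pauliZ (stdCube J.1)

/-- The logical operator `X_{e_J + ⟨[m] ∖ J⟩}`, the `X` operator of the `J`-th logical qubit. -/
def logicalX {m q r : ℕ} (J : LogicalQubit m q r) : QGate (Cube m) :=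
  onSet pauliX (subcube (incidence J.1) (J.1)ᶜ)

/-- `E` is (the matrix of) an encoder of `QRM_m(q, r)`: an isometry from the register of the logical
qubits onto the code space which carries the Pauli operators of every logical qubit `J` to the
logical operators `logicalZ J` and `logicalX J`. -/
structure IsEncoder {m q r : ℕ}
    (E : Matrix (Cube m → Fin 2) (LogicalQubit m q r → Fin 2) ℂ) : Prop where
  isometry : E.conjTranspose * E = 1
  range_eq : LinearMap.range E.mulVecLin = code m q r
  map_Z : ∀ J : LogicalQubit m q r,
    (logicalZ J : Matrix (Cube m → Fin 2) (Cube m → Fin 2) ℂ) * E =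
      E * (onSet pauliZ {J} : QGate (LogicalQubit m q r)).1
  map_X : ∀ J : LogicalQubit m q r,
    (logicalX J : Matrix (Cube m → Fin 2) (Cube m → Fin 2) ℂ) * E =
      E * (onSet pauliX {J} : QGate (LogicalQubit m q r)).1

/-- The physical operator `U` implements the operator `V` on the logical qubits of `QRM_m(q, r)`:
encoders exist, and applying `U` after encoding is the same as encoding after applying `V`
(exactly, with no global phase). In particular `U` preserves the code space. -/
def Implements {m q r : ℕ} (U : QGate (Cube m))
    (V : Matrix (LogicalQubit m q r → Fin 2) (LogicalQubit m q r → Fin 2) ℂ) : Prop :=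
  (∃ E : Matrix (Cube m → Fin 2) (LogicalQubit m q r → Fin 2) ℂ, IsEncoder E) ∧
    ∀ E : Matrix (Cube m → Fin 2) (LogicalQubit m q r → Fin 2) ℂ, IsEncoder E →
      (U : Matrix (Cube m → Fin 2) (Cube m → Fin 2) ℂ) * E = E * V

/-- The `i`-th logical qubit `{i}` of the hypercube code `QRM_m(0, 1)`. -/
def hypercubeQubit {m : ℕ} (i : Fin m) : LogicalQubit m 0 1 := ⟨{i}, by simp⟩

end QRM

end

/-! View a physical basis state as a function `s` from the hypercube to `Fin 2`, read as 𝔽₂. The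
checks on 2-cubes kill its mixed second differences, so code words are supported on affine
functions; the global `X` check makes amplitudes invariant under complement (`mem_code_zero_one`).
The logical `Z` on direction i reads the difference of `s` along an edge, so logical bits are
slopes: for any encoder, column `b` is supported on functions of slope `b` (`IsEncoder.hasSlope`).

An affine `s` restricted to ⟨K⟩ is balanced if some slope in K is 1, and constant otherwise
(`HasSlope.setPhase_subcube`). With ω = exp(iπ/2^(|K|-1)), the transversal gate therefore gives
ω^(2^(|K|-1)) = -1 in the balanced case, and 1 or ω^(2^|K|) = 1 in the constant case.

On the logical side, if t bits of K equal 1, then 2^t - 1 nonempty controlled gates fire, an odd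
number exactly when t > 0 (`ctrlZCircuit_powerset`). The two diagonal operators thus agree on the
support of every encoder. Existence of an encoder is shown by superposing the two affine functions
of each slope. -/

namespace QRM

/-! ### Transversal operators in the computational basis -/

open Classical in
/-- The diagonal entry at `s` of a diagonal gate `w` applied to all qubits of `A`. -/
noncomputable def setPhase {ι : Type} [Fintype ι] (w : Fin 2 → ℂ) (A : Set ι) (s : ι → Fin 2) : ℂ :=
  ∏ i, if i ∈ A then w (s i) else 1

theorem onSet_eq_diagonal {ι : Type} [Fintype ι] [DecidableEq ι]
    (U : Matrix.unitaryGroup (Fin 2) ℂ) (w : Fin 2 → ℂ)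
    (hU : (U : Matrix (Fin 2) (Fin 2) ℂ) = Matrix.diagonal w) (A : Set ι) :
    (onSet U A : Matrix (ι → Fin 2) (ι → Fin 2) ℂ) = Matrix.diagonal (setPhase w A) := by
  classical
  ext s t
  simp only [onSet, tensor, tensorMatrix, Matrix.of_apply]
  by_cases h : s = t
  · subst h
    rw [Matrix.diagonal_apply_eq, setPhase]
    refine Finset.prod_congr rfl fun i _ => ?_
    by_cases hi : i ∈ A <;> simp [hi, hU]
  · rw [Matrix.diagonal_apply_ne _ h]
    obtain ⟨i, hi⟩ := Function.ne_iff.mp h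
    refine Finset.prod_eq_zero (Finset.mem_univ i) ?_
    by_cases hA : i ∈ A <;> simp [hA, hU, hi]

theorem onSet_pauliZ {ι : Type} [Fintype ι] [DecidableEq ι] (A : Set ι) :
    (onSet pauliZ A : Matrix (ι → Fin 2) (ι → Fin 2) ℂ) =
      Matrix.diagonal (setPhase ![1, -1] A) := by
  refine onSet_eq_diagonal _ _ ?_ A
  ext i j
  fin_cases i <;> fin_cases j <;> simp [pauliZ]

theorem onSet_zRot {ι : Type} [Fintype ι] [DecidableEq ι] (k : ℤ) (A : Set ι) :
    (onSet (zRot k) A : Matrix (ι → Fin 2) (ι → Fin 2) ℂ) =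
      Matrix.diagonal
        (setPhase ![1, Complex.exp (((Real.pi / (2 : ℝ) ^ k : ℝ) : ℂ) * Complex.I)] A) := by
  refine onSet_eq_diagonal _ _ ?_ A
  ext i j
  fin_cases i <;> fin_cases j <;> simp [zRot]

open Classical in
/-- Flip the bits of `s` at all positions in `A`. -/
noncomputable def flipOn {ι : Type} (A : Set ι) (s : ι → Fin 2) : ι → Fin 2 :=
  fun i => if i ∈ A then s i + 1 else s i

theorem fin_two_add_self (a : Fin 2) : a + a = 0 := by
  revert a; decide

theorem flipOn_flipOn {ι : Type} (A : Set ι) (s : ι → Fin 2) : flipOn A (flipOn A s) = s := by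
  funext i
  by_cases hi : i ∈ A <;> simp [flipOn, hi, add_assoc, fin_two_add_self]

theorem onSet_pauliX_apply {ι : Type} [Fintype ι] [DecidableEq ι] (A : Set ι)
    (s t : ι → Fin 2) :
    (onSet pauliX A : Matrix (ι → Fin 2) (ι → Fin 2) ℂ) s t = if t = flipOn A s then 1 else 0 := by
  classical
  have hX : ∀ a b : Fin 2,
      (pauliX : Matrix (Fin 2) (Fin 2) ℂ) a b = if b = a + 1 then 1 else 0 := by
    intro a b
    fin_cases a <;> fin_cases b <;> simp [pauliX]
  simp only [onSet, tensor, tensorMatrix, Matrix.of_apply]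
  split_ifs with h
  · subst h
    refine Finset.prod_eq_one fun i _ => ?_
    by_cases hA : i ∈ A <;> simp [hA, hX, flipOn]
  · obtain ⟨i, hi⟩ := Function.ne_iff.mp h
    refine Finset.prod_eq_zero (Finset.mem_univ i) ?_
    by_cases hA : i ∈ A
    · simpa [hA, hX, flipOn] using hi
    · simpa [hA, hX, flipOn, Matrix.one_apply, eq_comm] using hi

theorem onSet_pauliX_mul_apply {ι κ : Type} [Fintype ι] [DecidableEq ι] (A : Set ι)
    (E : Matrix (ι → Fin 2) κ ℂ) (s : ι → Fin 2) (b : κ) :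
    ((onSet pauliX A : Matrix (ι → Fin 2) (ι → Fin 2) ℂ) * E) s b = E (flipOn A s) b := by
  simp [Matrix.mul_apply, onSet_pauliX_apply]

theorem mul_onSet_pauliX_apply {ι κ : Type} [Fintype ι] [DecidableEq ι] (A : Set ι)
    (E : Matrix κ (ι → Fin 2) ℂ) (s : κ) (b : ι → Fin 2) :
    (E * (onSet pauliX A : Matrix (ι → Fin 2) (ι → Fin 2) ℂ)) s b = E s (flipOn A b) := by
  have h : ∀ t : ι → Fin 2, b = flipOn A t ↔ t = flipOn A b := fun t =>
    ⟨fun h => by rw [h, flipOn_flipOn], fun h => by rw [h, flipOn_flipOn]⟩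
  simp [Matrix.mul_apply, onSet_pauliX_apply, h]

theorem onSet_pauliX_mulVec {ι : Type} [Fintype ι] [DecidableEq ι] (A : Set ι)
    (ψ : (ι → Fin 2) → ℂ) (s : ι → Fin 2) :
    (onSet pauliX A : Matrix (ι → Fin 2) (ι → Fin 2) ℂ).mulVec ψ s = ψ (flipOn A s) := by
  simp [Matrix.mulVec, dotProduct, onSet_pauliX_apply]

/-! ### Subcubes -/

theorem mem_subcube {m : ℕ} {x y : Cube m} {J : Finset (Fin m)} :
    y ∈ subcube x J ↔ ∀ i, i ∉ J → y i = x i := by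
  constructor
  · rintro ⟨z, hz, rfl⟩ i hi
    simp [hz i hi]
  · intro h
    exact ⟨y - x, fun i hi => by simp [h i hi], by simp⟩

theorem subcube_zero {m : ℕ} (J : Finset (Fin m)) : subcube 0 J = stdCube J := by
  ext y
  simp [mem_subcube, stdCube]

theorem zmod_two_eq (a : ZMod 2) : a = 0 ∨ a = 1 := by
  revert a; decide

theorem add_single_add_single {m : ℕ} (x : Cube m) (i : Fin m) :
    x + Pi.single i 1 + Pi.single i 1 = x := by
  have h : (1 : ZMod 2) + 1 = 0 := by decide
  rw [add_assoc, ← Pi.single_add, h, Pi.single_zero, add_zero]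

theorem mem_subcube_insert {m : ℕ} {x y : Cube m} {i : Fin m} {J : Finset (Fin m)} (hi : i ∉ J) :
    y ∈ subcube x (insert i J) ↔ y ∈ subcube x J ∨ y ∈ subcube (x + Pi.single i 1) J := by
  simp only [mem_subcube, Finset.mem_insert, not_or]
  constructor
  · intro h
    have h2 : y i = x i ∨ y i = x i + 1 := by
      generalize y i = a
      generalize x i = b
      revert a b; decide
    refine h2.imp (fun hy j hj => ?_) fun hy j hj => ?_
    · by_cases hji : j = i
      · rw [hji, hy]
      · exact h j ⟨hji, hj⟩
    · by_cases hji : j = i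
      · subst hji; simp [hy]
      · simpa [hji] using h j ⟨hji, hj⟩
  · rintro (h | h) j ⟨hji, hj⟩
    · exact h j hj
    · simpa [hji] using h j hj

/-- A cube is the disjoint union of two opposite facets, which differ in coordinate `i`. This drives
the inductions on dimension. -/
theorem setPhase_subcube_insert {m : ℕ} (w : Fin 2 → ℂ) (s : Cube m → Fin 2) (x : Cube m)
    {i : Fin m} {J : Finset (Fin m)} (hi : i ∉ J) :
    setPhase w (subcube x (insert i J)) s =
      setPhase w (subcube x J) s * setPhase w (subcube (x + Pi.single i 1) J) s := by
  classical
  simp only [setPhase]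
  rw [← Finset.prod_mul_distrib]
  refine Finset.prod_congr rfl fun y _ => ?_
  by_cases h1 : y ∈ subcube x J <;> by_cases h2 : y ∈ subcube (x + Pi.single i 1) J
  · have e1 := mem_subcube.mp h1 i hi
    have e2 := mem_subcube.mp h2 i hi
    simp [e1] at e2
  all_goals simp [mem_subcube_insert hi, h1, h2]

theorem setPhase_subcube_empty {m : ℕ} (w : Fin 2 → ℂ) (s : Cube m → Fin 2) (x : Cube m) :
    setPhase w (subcube x ∅) s = w (s x) := by
  classical
  have h : ∀ y, y ∈ subcube x ∅ ↔ y = x := fun y => by simp [mem_subcube, funext_iff]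
  simp [setPhase, h]

/-! ### Affine bit strings -/

/-- `s` is an affine function on the hypercube whose linear part has coefficients `b`. -/
def HasSlope {m : ℕ} (s : Cube m → Fin 2) (b : Fin m → Fin 2) : Prop :=
  ∀ x i, s (x + Pi.single i 1) = s x + b i

theorem HasSlope.unique {m : ℕ} {s : Cube m → Fin 2} {b c : Fin m → Fin 2}
    (hb : HasSlope s b) (hc : HasSlope s c) : b = c := by
  funext i
  have := (hb 0 i).symm.trans (hc 0 i)
  exact add_left_cancel this

/-- Any vertex is reached from the origin by flipping one coordinate at a time, and the slope
dictates each change. The induction is on a set containing the support of the vertex. -/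
theorem HasSlope.ext {m : ℕ} {s t : Cube m → Fin 2} {b : Fin m → Fin 2}
    (hs : HasSlope s b) (ht : HasSlope t b) (h0 : s 0 = t 0) : s = t := by
  have key : ∀ (J : Finset (Fin m)) (x : Cube m), (∀ i, i ∉ J → x i = 0) → s x = t x := by
    intro J
    induction J using Finset.induction_on with
    | empty =>
      intro x hx
      have : x = 0 := funext fun i => hx i (Finset.notMem_empty i)
      rw [this, h0]
    | insert i J hi ih =>
      intro x hx
      rcases zmod_two_eq (x i) with h | h
      · refine ih x fun j hj => ?_
        by_cases hji : j = i
        · rw [hji, h]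
        · exact hx j (by simp [hji, hj])
      · have h1 := ih (x + Pi.single i 1) fun j hj => by
          by_cases hji : j = i
          · subst hji
            simp only [Pi.add_apply, Pi.single_eq_same, h]
            decide
          · simp [hji, hx j (by simp [hji, hj])]
        rw [hs, ht] at h1
        exact add_right_cancel h1
  funext x
  exact key Finset.univ x fun i hi => absurd (Finset.mem_univ i) hi

/-- The linear function on the hypercube with coefficients `b`. -/
def linearString {m : ℕ} (b : Fin m → Fin 2) : Cube m → Fin 2 :=
  fun x => ∑ i, if x i = 1 then b i else 0

theorem linearString_zero {m : ℕ} (b : Fin m → Fin 2) : linearString b 0 = 0 := by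
  simp [linearString]

theorem hasSlope_linearString {m : ℕ} (b : Fin m → Fin 2) : HasSlope (linearString b) b := by
  intro x i
  have h : ∀ j, (if (x + Pi.single i 1 : Cube m) j = 1 then b j else 0) =
      (if x j = 1 then b j else 0) + if j = i then b i else 0 := by
    intro j
    by_cases hji : j = i
    · subst hji
      simp only [Pi.add_apply, Pi.single_eq_same, if_true]
      generalize x j = a
      generalize b j = c
      revert a c; decide
    · simp [hji]
  simp only [linearString, h, Finset.sum_add_distrib, Finset.sum_ite_eq', Finset.mem_univ, if_true]

theorem hasSlope_flipOn_univ {m : ℕ} {s : Cube m → Fin 2} {b : Fin m → Fin 2} :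
    HasSlope (flipOn Set.univ s) b ↔ HasSlope s b := by
  simp only [HasSlope, flipOn, Set.mem_univ, if_true]
  refine forall₂_congr fun x i => ?_
  rw [add_right_comm]
  exact add_left_inj 1

theorem HasSlope.eq_or {m : ℕ} {s : Cube m → Fin 2} {b : Fin m → Fin 2} (hs : HasSlope s b) :
    s = linearString b ∨ s = flipOn Set.univ (linearString b) := by
  have h : s 0 = 0 ∨ s 0 = 1 := by
    generalize s 0 = a
    revert a; decide
  refine h.imp (fun h => ?_) fun h => ?_
  · exact hs.ext (hasSlope_linearString b) (by rw [h, linearString_zero])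
  · exact hs.ext (hasSlope_flipOn_univ.mpr (hasSlope_linearString b))
      (by simp [h, flipOn, linearString_zero])

theorem flipOn_univ_ne {m : ℕ} (s : Cube m → Fin 2) : s ≠ flipOn Set.univ s := by
  intro h
  have := congrFun h 0
  simp [flipOn] at this

/-- The balanced-or-constant dichotomy. The truncated subtraction is harmless, since its branch
forces `J` to be nonempty. -/
theorem HasSlope.setPhase_subcube {m : ℕ} {s : Cube m → Fin 2} {b : Fin m → Fin 2}
    (hs : HasSlope s b) (w : Fin 2 → ℂ) (J : Finset (Fin m)) (x : Cube m) :
    setPhase w (subcube x J) s =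
      if ∃ i ∈ J, b i = 1 then (w 0 * w 1) ^ 2 ^ (J.card - 1) else w (s x) ^ 2 ^ J.card := by
  induction J using Finset.induction_on generalizing x with
  | empty => simp [setPhase_subcube_empty]
  | insert i J hi ih =>
    rw [setPhase_subcube_insert w s x hi, ih, ih, Finset.card_insert_of_notMem hi,
      Nat.add_sub_cancel, hs]
    by_cases hJ : ∃ j ∈ J, b j = 1
    · have hins : ∃ j ∈ insert i J, b j = 1 := by
        obtain ⟨j, hj, hb⟩ := hJ
        exact ⟨j, Finset.mem_insert_of_mem hj, hb⟩
      have hpos : 0 < J.card := Finset.card_pos.mpr ⟨hJ.choose, hJ.choose_spec.1⟩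
      rw [if_pos hJ, if_pos hJ, if_pos hins, ← pow_add, ← two_mul, ← pow_succ',
        Nat.sub_add_cancel hpos]
    · rw [if_neg hJ, if_neg hJ, ← mul_pow]
      -- Here `s` is constant on each facet; `b i` decides whether the two constants are opposite or
      -- equal.
      by_cases hbi : b i = 1
      · rw [if_pos ⟨i, Finset.mem_insert_self i J, hbi⟩, hbi]
        congr 1
        generalize s x = a
        fin_cases a
        · simp
        · simp [mul_comm]
      · have hins : ¬ ∃ j ∈ insert i J, b j = 1 := by
          rintro ⟨j, hj, hb⟩
          rcases Finset.mem_insert.mp hj with rfl | hj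
          · exact hbi hb
          · exact hJ ⟨j, hj, hb⟩
        have hb0 : b i = 0 := by
          revert hbi
          generalize b i = a
          revert a; decide
        rw [if_neg hins, hb0, add_zero, ← pow_two, ← pow_mul, ← pow_succ']

/-- The difference of `s` in direction `i` has zero slope in every direction, hence is constant and
equal to its value at the origin. Characteristic 2 turns differences into sums and makes the
direction `i` itself automatic. -/
theorem hasSlope_of_mixed_difference {m : ℕ} {s : Cube m → Fin 2}
    (h : ∀ (x : Cube m) (i j : Fin m), i ≠ j →
      s x + s (x + Pi.single i 1) + s (x + Pi.single j 1) +
        s (x + Pi.single j 1 + Pi.single i 1) = 0) :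
    HasSlope s fun i => s 0 + s (Pi.single i 1) := by
  intro x i
  have hc : HasSlope (fun x => s x + s (x + Pi.single i 1)) 0 := by
    intro y j
    by_cases hij : i = j
    · subst hij
      simp only [add_single_add_single, Pi.zero_apply, add_zero]
      exact add_comm _ _
    · have := h y i j hij
      simp only [Pi.zero_apply, add_zero]
      revert this
      generalize s y = a1
      generalize s (y + Pi.single i 1) = a2
      generalize s (y + Pi.single j 1) = a3
      generalize s (y + Pi.single j 1 + Pi.single i 1) = a4
      revert a1 a2 a3 a4; decide
  have hk : HasSlope (fun _ : Cube m => s 0 + s (Pi.single i 1)) 0 := by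
    intro y j; simp
  have := congrFun (hc.ext hk (by simp)) x
  change _ = s x + (s 0 + s (Pi.single i 1))
  change s x + s (x + Pi.single i 1) = s 0 + s (Pi.single i 1) at this
  rw [← this, ← add_assoc, fin_two_add_self, zero_add]

/-! ### The code space of the hypercube code -/

theorem diagonal_mulVec_eq_self_iff {n : Type*} [Fintype n] [DecidableEq n] (d ψ : n → ℂ) :
    (Matrix.diagonal d).mulVec ψ = ψ ↔ ∀ s, ψ s ≠ 0 → d s = 1 := by
  simp only [funext_iff, Matrix.mulVec_diagonal]
  refine forall_congr' fun s => ⟨fun h h0 => mul_right_cancel₀ h0 (by rw [h, one_mul]), fun h => ?_⟩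
  by_cases h0 : ψ s = 0
  · simp [h0]
  · rw [h h0, one_mul]

/-- Being fixed passes from generators to products and inverses. `X` generators permute amplitudes,
while diagonal `Z` generators only restrict the support. -/
theorem mem_code_iff_generators {m q r : ℕ} (ψ : (Cube m → Fin 2) → ℂ) :
    ψ ∈ code m q r ↔
      (∀ A : Set (Cube m), IsSubcube (m - q) A → ∀ s, ψ (flipOn A s) = ψ s) ∧
      ∀ A : Set (Cube m), IsSubcube (r + 1) A → ∀ s, ψ s ≠ 0 → setPhase ![1, -1] A s = 1 := by
  rw [mem_code]
  constructor
  · intro h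
    constructor
    · intro A hA s
      rw [← onSet_pauliX_mulVec A ψ, h _ (Subgroup.subset_closure (Or.inl ⟨A, hA, rfl⟩))]
    · intro A hA
      rw [← diagonal_mulVec_eq_self_iff, ← onSet_pauliZ]
      exact h _ (Subgroup.subset_closure (Or.inr ⟨A, hA, rfl⟩))
  · rintro ⟨hX, hZ⟩ S hS
    induction hS using Subgroup.closure_induction with
    | mem S hS =>
      rcases hS with ⟨A, hA, rfl⟩ | ⟨A, hA, rfl⟩
      · funext s
        rw [onSet_pauliX_mulVec, hX A hA]
      · rw [onSet_pauliZ, diagonal_mulVec_eq_self_iff]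
        exact hZ A hA
    | one => simp
    | mul S T _ _ hS hT => rw [Submonoid.coe_mul, ← Matrix.mulVec_mulVec, hT, hS]
    | inv S _ hS =>
      have h1 : (S⁻¹ : QGate (Cube m)).1 * S.1 = 1 := by
        rw [← Submonoid.coe_mul, inv_mul_cancel, Submonoid.coe_one]
      -- Only the left `ψ` is replaced by `S ψ`, so that the inverse cancels.
      conv_lhs => rw [← hS]
      rw [Matrix.mulVec_mulVec, h1, Matrix.one_mulVec]

theorem isSubcube_top_iff {m : ℕ} {A : Set (Cube m)} : IsSubcube (m - 0) A ↔ A = Set.univ := by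
  constructor
  · rintro ⟨x, J, hJ, rfl⟩
    have : J = Finset.univ := by
      rw [← Finset.card_eq_iff_eq_univ, hJ, Fintype.card_fin, Nat.sub_zero]
    ext y
    simp [mem_subcube, this]
  · rintro rfl
    refine ⟨0, Finset.univ, by simp, ?_⟩
    ext y
    simp [mem_subcube]

/-- The phase on a square is -1 to the sum of its four bits. -/
theorem setPhase_pauliZ_square {m : ℕ} (s : Cube m → Fin 2) (x : Cube m) {i j : Fin m}
    (hij : i ≠ j) (h : setPhase ![1, -1] (subcube x {j, i}) s = 1) :
    s x + s (x + Pi.single i 1) + s (x + Pi.single j 1) +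
      s (x + Pi.single j 1 + Pi.single i 1) = 0 := by
  have e : ∀ y : Cube m, setPhase ![1, -1] (subcube y {i}) s =
      ![1, -1] (s y) * ![1, -1] (s (y + Pi.single i 1)) := by
    intro y
    rw [← insert_empty_eq, setPhase_subcube_insert _ _ _ (Finset.notMem_empty i),
      setPhase_subcube_empty, setPhase_subcube_empty]
  rw [setPhase_subcube_insert _ _ _ (by simpa using hij.symm), e, e] at h
  revert h
  generalize s x = a1
  generalize s (x + Pi.single i 1) = a2
  generalize s (x + Pi.single j 1) = a3
  generalize s (x + Pi.single j 1 + Pi.single i 1) = a4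
  fin_cases a1 <;> fin_cases a2 <;> fin_cases a3 <;> fin_cases a4 <;>
    first | (intro; decide) | (intro h; norm_num at h)

theorem mem_code_zero_one {m : ℕ} (ψ : (Cube m → Fin 2) → ℂ) :
    ψ ∈ code m 0 1 ↔ (∀ s, ψ (flipOn Set.univ s) = ψ s) ∧ ∀ s, ψ s ≠ 0 → ∃ b, HasSlope s b := by
  rw [mem_code_iff_generators]
  simp only [isSubcube_top_iff, forall_eq]
  refine and_congr_right fun _ => ⟨fun h s hs => ?_, ?_⟩
  · refine ⟨_, hasSlope_of_mixed_difference fun x i j hij => setPhase_pauliZ_square s x hij ?_⟩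
    exact h _ ⟨x, {j, i}, Finset.card_pair hij.symm, rfl⟩ s hs
  · rintro h A ⟨x, J, hJ, rfl⟩ s hs
    obtain ⟨b, hb⟩ := h s hs
    -- On a 2-cube the phase is (-1)^2 if `s` is balanced and (±1)^4 if it is constant.
    rw [hb.setPhase_subcube, hJ]
    split_ifs
    · norm_num
    · generalize s x = a
      fin_cases a <;> norm_num

/-! ### Encoders -/

theorem hypercubeQubit_bijective {m : ℕ} :
    Function.Bijective (hypercubeQubit : Fin m → LogicalQubit m 0 1) := by
  constructor
  · intro i j h
    simpa [hypercubeQubit] using h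
  · rintro ⟨J, h1, h2⟩
    obtain ⟨i, rfl⟩ := Finset.card_eq_one.mp (le_antisymm h2 h1)
    exact ⟨i, rfl⟩

/-- The bits of the state of the logical register, indexed by the directions of the hypercube. -/
def slopeOf {m : ℕ} (b : LogicalQubit m 0 1 → Fin 2) : Fin m → Fin 2 :=
  fun i => b (hypercubeQubit i)

theorem slopeOf_bijective {m : ℕ} :
    Function.Bijective (slopeOf : (LogicalQubit m 0 1 → Fin 2) → Fin m → Fin 2) :=
  hypercubeQubit_bijective.comp_right

theorem setPhase_singleton {ι : Type} [Fintype ι] (w : Fin 2 → ℂ) (i : ι) (s : ι → Fin 2) :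
    setPhase w {i} s = w (s i) := by
  classical
  simp [setPhase]

theorem HasSlope.setPhase_logicalZ {m : ℕ} {s : Cube m → Fin 2} {b : Fin m → Fin 2}
    (hs : HasSlope s b) (i : Fin m) :
    setPhase ![1, -1] (stdCube {i}) s = ![1, -1] (b i) := by
  rw [← subcube_zero, hs.setPhase_subcube]
  simp only [Finset.mem_singleton, exists_eq_left, Finset.card_singleton]
  generalize s 0 = a
  generalize b i = c
  fin_cases a <;> fin_cases c <;> simp

open Classical in
/-- The encoder which sends a computational basis state `b` to the uniform superposition of the two
affine functions with slope `b`. -/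
noncomputable def hypercubeEncoder (m : ℕ) : Matrix (Cube m → Fin 2) (LogicalQubit m 0 1 → Fin 2) ℂ :=
  Matrix.of fun s b => if HasSlope s (slopeOf b) then ((Real.sqrt 2 : ℝ) : ℂ)⁻¹ else 0

/-- Each column is supported on one affine function and its complement; uniqueness of the slope
makes different columns disjoint. -/
theorem hypercubeEncoder_isometry (m : ℕ) :
    (hypercubeEncoder m).conjTranspose * hypercubeEncoder m = 1 := by
  classical
  ext b c
  simp only [Matrix.mul_apply, Matrix.conjTranspose_apply, hypercubeEncoder, Matrix.of_apply]
  by_cases hbc : b = c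
  · subst hbc
    have hf : (Finset.univ.filter fun s : Cube m → Fin 2 => HasSlope s (slopeOf b)) =
        {linearString (slopeOf b), flipOn Set.univ (linearString (slopeOf b))} := by
      ext s
      simp only [Finset.mem_filter, Finset.mem_univ, true_and, Finset.mem_insert,
        Finset.mem_singleton]
      refine ⟨HasSlope.eq_or, ?_⟩
      rintro (rfl | rfl)
      · exact hasSlope_linearString _
      · exact hasSlope_flipOn_univ.mpr (hasSlope_linearString _)
    have hsq : ((Real.sqrt 2 : ℝ) : ℂ)⁻¹ * ((Real.sqrt 2 : ℝ) : ℂ)⁻¹ = 2⁻¹ := by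
      rw [← mul_inv, ← Complex.ofReal_mul, Real.mul_self_sqrt (by norm_num)]
      norm_num
    have he : ∀ s : Cube m → Fin 2,
        star (if HasSlope s (slopeOf b) then ((Real.sqrt 2 : ℝ) : ℂ)⁻¹ else 0) *
          (if HasSlope s (slopeOf b) then ((Real.sqrt 2 : ℝ) : ℂ)⁻¹ else 0) =
        if HasSlope s (slopeOf b) then 2⁻¹ else 0 := by
      intro s
      split_ifs
      · rw [star_inv₀, Complex.star_def, Complex.conj_ofReal, hsq]
      · simp
    rw [Finset.sum_congr rfl fun s _ => he s, ← Finset.sum_filter, hf,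
      Finset.sum_pair (flipOn_univ_ne _), Matrix.one_apply_eq]
    norm_num
  · rw [Matrix.one_apply_ne hbc]
    refine Finset.sum_eq_zero fun s _ => ?_
    by_cases hb : HasSlope s (slopeOf b)
    · have hc : ¬ HasSlope s (slopeOf c) := fun hc =>
        hbc (slopeOf_bijective.injective (hb.unique hc))
      simp [hc]
    · simp [hb]

theorem hypercubeEncoder_range (m : ℕ) :
    LinearMap.range (hypercubeEncoder m).mulVecLin = code m 0 1 := by
  classical
  apply le_antisymm
  · rintro _ ⟨φ, rfl⟩
    rw [mem_code_zero_one]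
    constructor
    · intro s
      simp [Matrix.mulVec, dotProduct, hypercubeEncoder, hasSlope_flipOn_univ]
    · intro s hs
      by_contra! h
      exact hs (by simp [Matrix.mulVec, dotProduct, hypercubeEncoder, h])
  · intro ψ hψ
    rw [mem_code_zero_one] at hψ
    obtain ⟨hX, hZ⟩ := hψ
    -- By complement invariance the linear representative of each slope determines `ψ`; the factor
    -- √2 undoes the normalization.
    refine ⟨fun b => ((Real.sqrt 2 : ℝ) : ℂ) * ψ (linearString (slopeOf b)), ?_⟩
    funext s
    simp only [Matrix.mulVecLin_apply, Matrix.mulVec, dotProduct, hypercubeEncoder,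
      Matrix.of_apply]
    by_cases h : ∃ b, HasSlope s b
    · obtain ⟨b', hb⟩ := h
      obtain ⟨b, rfl⟩ := slopeOf_bijective.surjective b'
      have h2 : ((Real.sqrt 2 : ℝ) : ℂ) ≠ 0 := by simp
      rw [Finset.sum_eq_single b]
      · rw [if_pos hb, inv_mul_cancel_left₀ h2]
        rcases hb.eq_or with e | e
        · rw [e]
        · rw [e, hX]
      · intro c _ hc
        rw [if_neg, zero_mul]
        exact fun h' => hc (slopeOf_bijective.injective (h'.unique hb))
      · simp
    · have h0 : ψ s = 0 := by
        by_contra h0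
        exact h (hZ s h0)
      rw [h0]
      refine Finset.sum_eq_zero fun b _ => ?_
      rw [if_neg fun hb => h ⟨_, hb⟩, zero_mul]

/-- The logical `X` flips the facet where coordinate `i` is 1, that is, adds the i-th coordinate
function to `s`; only the i-th slope changes. -/
theorem hasSlope_flipOn_logicalX {m : ℕ} (s : Cube m → Fin 2) (b : LogicalQubit m 0 1 → Fin 2)
    (i : Fin m) :
    HasSlope (flipOn (subcube (incidence {i}) ({i} : Finset (Fin m))ᶜ) s) (slopeOf b) ↔
      HasSlope s (slopeOf (flipOn {hypercubeQubit i} b)) := by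
  have hA : ∀ x, x ∈ subcube (incidence {i}) ({i} : Finset (Fin m))ᶜ ↔ x i = 1 := by
    intro x
    simp [mem_subcube, incidence]
  refine forall₂_congr fun x j => ?_
  simp only [flipOn, hA, slopeOf, Set.mem_singleton_iff, hypercubeQubit_bijective.injective.eq_iff]
  by_cases hji : j = i
  · subst hji
    simp only [Pi.add_apply, Pi.single_eq_same, if_true]
    generalize x j = a
    generalize s x = c
    generalize s _ = d
    generalize b _ = e
    revert a c d e; decide
  · simp only [Pi.add_apply, Pi.single_eq_of_ne (Ne.symm hji), add_zero, hji, if_false]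
    by_cases hx : x i = 1
    · simp only [hx, if_true]
      rw [add_right_comm]
      exact add_left_inj 1
    · simp [hx]

theorem isEncoder_hypercubeEncoder (m : ℕ) : IsEncoder (hypercubeEncoder m) where
  isometry := hypercubeEncoder_isometry m
  range_eq := hypercubeEncoder_range m
  map_Z := by
    intro J
    obtain ⟨i, rfl⟩ := hypercubeQubit_bijective.surjective J
    ext s b
    rw [logicalZ, onSet_pauliZ, onSet_pauliZ, Matrix.diagonal_mul, Matrix.mul_diagonal,
      setPhase_singleton]
    by_cases h : HasSlope s (slopeOf b)
    · rw [mul_comm]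
      congr 1
      exact h.setPhase_logicalZ i
    · simp [hypercubeEncoder, h]
  map_X := by
    intro J
    obtain ⟨i, rfl⟩ := hypercubeQubit_bijective.surjective J
    ext s b
    rw [logicalX, onSet_pauliX_mul_apply, mul_onSet_pauliX_apply]
    simp only [hypercubeEncoder, Matrix.of_apply]
    classical
    exact if_congr (hasSlope_flipOn_logicalX s b i) rfl rfl

/-- Column `b` lies in the code, so `s` has some slope `c`. Comparing the entry at `(s, b)` in the
intertwining relation for each logical `Z` forces `c` to agree with `b`. -/
theorem IsEncoder.hasSlope {m : ℕ} {E : Matrix (Cube m → Fin 2) (LogicalQubit m 0 1 → Fin 2) ℂ}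
    (hE : IsEncoder E) {s : Cube m → Fin 2} {b : LogicalQubit m 0 1 → Fin 2} (h : E s b ≠ 0) :
    HasSlope s (slopeOf b) := by
  have hcol : E.mulVecLin (Pi.single b 1) ∈ code m 0 1 := hE.range_eq ▸ LinearMap.mem_range_self _ _
  obtain ⟨c, hc⟩ := ((mem_code_zero_one _).mp hcol).2 s (by simpa using h)
  have : c = slopeOf b := by
    funext i
    have hz := congrFun (congrFun (hE.map_Z (hypercubeQubit i)) s) b
    rw [logicalZ, onSet_pauliZ, onSet_pauliZ, Matrix.diagonal_mul, Matrix.mul_diagonal,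
      setPhase_singleton, mul_comm] at hz
    have hz' := (hc.setPhase_logicalZ i).symm.trans (mul_left_cancel₀ h hz)
    change ![(1 : ℂ), -1] (c i) = ![1, -1] (slopeOf b i) at hz'
    revert hz'
    generalize c i = a
    generalize slopeOf b i = a'
    fin_cases a <;> fin_cases a' <;> norm_num
  exact this ▸ hc

/-! ### Multi-controlled-`Z` circuits -/

open Classical in
theorem ctrlZCircuit_eq_diagonal {ι : Type} [Fintype ι] [DecidableEq ι] (F : Finset (Finset ι)) :
    ctrlZCircuit F = Matrix.diagonal fun s =>
      ∏ I ∈ F, if I.Nonempty ∧ ∀ i ∈ I, s i = 1 then (-1 : ℂ) else 1 := by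
  -- Quantifying over the commutativity proof lets the induction change `F`.
  have key : ∀ h : (F : Set (Finset ι)).Pairwise (Function.onFun Commute ctrlZ),
      F.noncommProd ctrlZ h = Matrix.diagonal fun s =>
        ∏ I ∈ F, if I.Nonempty ∧ ∀ i ∈ I, s i = 1 then (-1 : ℂ) else 1 := by
    induction F using Finset.induction_on with
    | empty => intro h; simp [Finset.noncommProd_empty]
    | insert I F hI ih =>
      intro h
      rw [Finset.noncommProd_insert_of_notMem _ _ _ _ hI, ih, ctrlZ,
        Matrix.diagonal_mul_diagonal]
      congr 1
      funext s
      rw [Finset.prod_insert hI]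
  exact key _

open Classical in
theorem ctrlZCircuit_powerset {ι : Type} [Fintype ι] [DecidableEq ι] (T : Finset ι) :
    ctrlZCircuit T.powerset = Matrix.diagonal fun s =>
      if ∃ i ∈ T, s i = 1 then (-1 : ℂ) else 1 := by
  rw [ctrlZCircuit_eq_diagonal]
  congr 1
  funext s
  -- The firing gates are the nonempty sets of one-bits; erasing `∅` makes their number odd unless
  -- there are no one-bits.
  have hf : (T.powerset.filter fun I => I.Nonempty ∧ ∀ i ∈ I, s i = 1) =
      (T.filter fun i => s i = 1).powerset.erase ∅ := by
    ext I
    simp only [Finset.mem_filter, Finset.mem_powerset, Finset.mem_erase, ne_eq,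
      ← Finset.nonempty_iff_ne_empty, Finset.subset_iff]
    grind
  rw [Finset.prod_ite, Finset.prod_const, Finset.prod_const_one, mul_one, hf,
    Finset.card_erase_of_mem (Finset.empty_mem_powerset _), Finset.card_powerset]
  split_ifs with h
  · obtain ⟨i, hi, hs⟩ := h
    have hpos : (T.filter fun i => s i = 1).card ≠ 0 :=
      (Finset.card_pos.mpr ⟨i, Finset.mem_filter.mpr ⟨hi, hs⟩⟩).ne'
    refine Odd.neg_one_pow (Nat.Even.sub_odd Nat.one_le_two_pow ?_ odd_one)
    exact (Nat.even_pow.mpr ⟨even_two, hpos⟩)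
  · have h0 : (T.filter fun i => s i = 1) = ∅ :=
      Finset.filter_eq_empty_iff.mpr fun i hi hs => h ⟨i, hi, hs⟩
    simp [h0]

theorem exp_pi_div_two_zpow_pow (k : ℕ) :
    Complex.exp (((Real.pi / (2 : ℝ) ^ ((k : ℤ)) : ℝ) : ℂ) * Complex.I) ^ 2 ^ k = -1 := by
  rw [← Complex.exp_nat_mul, ← Complex.exp_pi_mul_I]
  congr 1
  push_cast
  rw [zpow_natCast]
  field_simp

/-- The constant case with all bits 1. The integer exponent also covers `k = 0`, where the rotation
is already a full turn. -/
theorem exp_pi_div_two_zpow_sub_one_pow (k : ℕ) :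
    Complex.exp (((Real.pi / (2 : ℝ) ^ ((k : ℤ) - 1) : ℝ) : ℂ) * Complex.I) ^ 2 ^ k = 1 := by
  rw [← Complex.exp_nat_mul, ← Complex.exp_two_pi_mul_I]
  congr 1
  push_cast
  rw [zpow_sub_one₀ two_ne_zero, zpow_natCast]
  field_simp

theorem HasSlope.setPhase_zRot {m : ℕ} {s : Cube m → Fin 2} {b : Fin m → Fin 2}
    (hs : HasSlope s b) (K : Finset (Fin m)) :
    setPhase ![1, Complex.exp
      (((Real.pi / (2 : ℝ) ^ ((K.card : ℤ) - 1) : ℝ) : ℂ) * Complex.I)] (stdCube K) s =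
      if ∃ i ∈ K, b i = 1 then -1 else 1 := by
  rw [← subcube_zero, hs.setPhase_subcube]
  split_ifs with h
  · have hpos : 1 ≤ K.card := Finset.card_pos.mpr ⟨h.choose, h.choose_spec.1⟩
    have hc : (K.card : ℤ) - 1 = ((K.card - 1 : ℕ) : ℤ) := by omega
    rw [hc, Matrix.cons_val_zero, Matrix.cons_val_one, Matrix.cons_val_fin_one, one_mul,
      exp_pi_div_two_zpow_pow]
  · generalize s 0 = a
    fin_cases a
    · simp
    · exact exp_pi_div_two_zpow_sub_one_pow _

end QRM

theorem mainTheorem5 (m : ℕ) (hm : 1 ≤ m) (K : Finset (Fin m)) :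
    QRM.Implements (q := 0) (r := 1)
      (QRM.onSet (QRM.zRot ((K.card : ℤ) - 1)) (QRM.stdCube K))
      (QRM.ctrlZCircuit (K.image QRM.hypercubeQubit).powerset) := by
  classical
  refine ⟨⟨_, QRM.isEncoder_hypercubeEncoder m⟩, fun E hE => ?_⟩
  ext s b
  rw [QRM.onSet_zRot, QRM.ctrlZCircuit_powerset, Matrix.diagonal_mul, Matrix.mul_diagonal]
  -- Both operators are diagonal, so each only rescales the entry `E s b`; a nonzero entry fixes the
  -- slope of `s`.
  by_cases h : E s b = 0
  · simp [h]
  · rw [(hE.hasSlope h).setPhase_zRot, mul_comm]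
    congr 1
    simp only [QRM.slopeOf, Finset.exists_mem_image]
    congr 1
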